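/- Let $X$ be a finite set of clocks and let $L,U:X\to\mathbb N$. A valuation is a function $v:X\to\mathbb R_{\ge 0}$. A zone is a set of valuations defined by a finite conjunction of constraints $x\,\#\,c$ and $x-y\,\#\,c$, where $x,y\in X$, $\#\in\{<,\le,=,\ge,>\}$ and $c\in\mathbb N$. Write $v\preccurlyeq_{LU}v'$ if for every $x\in X$: $v'(x)<v(x)$ implies $v'(x)>L_x$, and $v'(x)>v(x)$ implies $v(x)>U_x$. For a set $W$ of valuations put $\mathfrak a_{\preccurlyeq LU}(W)=\{v : \exists v'\in W,\ v\preccurlyeq_{LU}v'\}$. A weight is $(\lessdot,c)$ with $\lessdot\in\{<,\le\}$ and $c\in\mathbb Z$, or $(<,\infty)$. Weights are ordered by: $(\lessdot_1,c_1)<(\lessdot_2,c_2)$ iff $c_1<c_2$, or $c_1=c_2$, $\lessdot_1$ is $<$ and $\lessdot_2$ is $\le$. They are added by $(\lessdot_1,c_1)+(\lessdot_2,c_2)=(\lessdot,c_1+c_2)$, where $\lessdot$ is $\le$ if both $\lessdot_1,\lessdot_2$ are $\le$, and $<$ otherwise. A distance graph has the vertices $X\cup\{x_0\}$ and a weight $(\lessdot_{xy},c_{xy})$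 for every pair of vertices, representing the constraint $y-x\lessdot_{xy}c_{xy}$, where $x_0$ has the value $0$. The graph is canonical if the weight of each edge $x\to y$ is the greatest lower bound of the weights of all paths from $x$ to $y$ (the empty path from $x$ to $x$ has weight $(\le,0)$). For a non-empty zone $Z$ let $Z_{xy}$ be the weight of $x\to y$ in the canonical distance graph of $Z$, that is, the canonical graph that defines $Z$ and whose constraints include $0\le x$ for all clocks $x$. Write $0$ for $x_0$ in indices and put $L_{x_0}=U_{x_0}=0$. Theorem. (1) Let $Z,Z'$ be non-empty zones over $X$. Then $Z\not\subseteq\mathfrak a_{\preccurlyeq LU}(Z')$ if and only if there are $x,y\in X\cup\{x_0\}$ such that $$Z_{x0}\ge(\le,-U_x)\quad\text{and}\quad Z'_{xy}<Z_{xy}\quad\text{and}\quad Z'_{xy}+(<,-L_y)<Z_{x0}.$$ (2) There is an algorithm that, given $L$, $U$ and the canonical distance graphs of two non-empty zones $Z,Z'$ over $n$ clocks, decides whether $Z\subseteq\mathfrak a_{\preccurlyeq LU}(Z')$ in $O(n^2+1)$ steps. More precisely, there are one fixed program of a unit-cost random access machine over the integers (constants, addition, subtraction, indirect load and store, comparison;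 each instruction and each test is one step) and one constant $C$ such that for all $n\ge 0$ and all such inputs the program halts after at most $C(n^2+1)$ steps with the correct answer. -/

import Mathlib

namespace LUZone

open scoped NNReal

/-! ### Clock valuations and zones -/

/-- A clock valuation over `X`: every clock has a non-negative real value. -/
abbrev ClockValuation (X : Type*) := X → ℝ≥0

/-- The comparison symbols `<, ≤, =, ≥, >`. -/
inductive Cmp
  | lt | le | eq | ge | gt

/-- `op.Holds a b` says that `a op b` is true. -/
def Cmp.Holds : Cmp → ℝ → ℝ → Prop
  | .lt, a, b => a < b
  | .le, a, b => a ≤ b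
  | .eq, a, b => a = b
  | .ge, a, b => a ≥ b
  | .gt, a, b => a > b

/-- The constraints `x # c` and `x - y # c` with `c ∈ ℕ` from which zones are built. -/
inductive ZoneConstraint (X : Type*)
  | clock (x : X) (op : Cmp) (c : ℕ)
  | diff (x y : X) (op : Cmp) (c : ℕ)

/-- Satisfaction of a constraint by a valuation. The difference is taken in `ℝ`. -/
def ZoneConstraint.Sat {X : Type*} (v : ClockValuation X) : ZoneConstraint X → Prop
  | .clock x op c => op.Holds (v x : ℝ) (c : ℝ)
  | .diff x y op c => op.Holds ((v x : ℝ) - (v y : ℝ)) (c : ℝ)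

/-- A zone is a set of valuations defined by a finite conjunction of constraints. -/
def IsZone {X : Type*} (Z : Set (ClockValuation X)) : Prop :=
  ∃ cs : List (ZoneConstraint X), Z = {v | ∀ φ ∈ cs, φ.Sat v}

/-! ### The LU-abstraction -/

/-- The LU-preorder `v ≼ v'`. -/
def LUPreorder {X : Type*} (L U : X → ℕ) (v v' : ClockValuation X) : Prop :=
  ∀ x, (v' x < v x → (L x : ℝ≥0) < v' x) ∧ (v x < v' x → (U x : ℝ≥0) < v x)

/-- The abstraction `𝔞_{≼LU}(W) = {v | ∃ v' ∈ W, v ≼ v'}`. -/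
def aLU {X : Type*} (L U : X → ℕ) (W : Set (ClockValuation X)) : Set (ClockValuation X) :=
  {v | ∃ v' ∈ W, LUPreorder L U v v'}

/-! ### Weights -/

/-- Weights: `strict c` is `(<, c)`, `weak c` is `(≤, c)` and `infty` is `(<, ∞)`. -/
inductive Weight
  | strict (c : ℤ)
  | weak (c : ℤ)
  | infty

namespace Weight

/-- `w.Holds d` says that the real number `d` obeys the bound `w`. -/
def Holds : Weight → ℝ → Prop
  | strict c, d => d < (c : ℝ)
  | weak c, d => d ≤ (c : ℝ)
  | infty, _ => True

/-- The (non-strict) order of weights: bounds are compared first, and for equal bounds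
`(<, c)` is below `(≤, c)`; the weight `(<, ∞)` is the greatest one. -/
protected def Le : Weight → Weight → Prop
  | _, infty => True
  | infty, strict _ => False
  | infty, weak _ => False
  | strict a, strict b => a ≤ b
  | strict a, weak b => a ≤ b
  | weak a, weak b => a ≤ b
  | weak a, strict b => a < b

noncomputable instance : LinearOrder Weight where
  le := Weight.Le
  le_refl a := by cases a <;> simp [Weight.Le]
  le_trans a b c := by
    cases a <;> cases b <;> cases c <;> simp only [Weight.Le] <;> grind
  le_antisymm a b := by
    cases a <;> cases b <;> simp only [Weight.Le] <;> grind
  le_total a b := by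
    cases a <;> cases b <;> simp only [Weight.Le] <;> grind
  toDecidableLE := Classical.decRel _

/-- Addition of weights: the bounds are added, and the sum is strict iff one of the two
summands is strict. -/
protected def add : Weight → Weight → Weight
  | infty, _ => infty
  | _, infty => infty
  | weak a, weak b => weak (a + b)
  | weak a, strict b => strict (a + b)
  | strict a, weak b => strict (a + b)
  | strict a, strict b => strict (a + b)

instance : Add Weight := ⟨Weight.add⟩

end Weight

/-! ### Distance graphs -/

/-- A distance graph over the clocks `X`. The vertices are the clocks and the special clock
`x₀ = none`; `G x y` is the weight of the edge from `x` to `y`, which represents the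
constraint that `y - x` obeys `G x y`. -/
abbrev DistGraph (X : Type*) := Option X → Option X → Weight

/-- The value of a vertex; the special clock `x₀` has the value `0`. -/
def vertexValue {X : Type*} (v : ClockValuation X) : Option X → ℝ
  | none => 0
  | some x => (v x : ℝ)

/-- The valuations that satisfy all constraints of `G`. -/
def DistGraph.sem {X : Type*} (G : DistGraph X) : Set (ClockValuation X) :=
  {v | ∀ x y, (G x y).Holds (vertexValue v y - vertexValue v x)}

/-- `G.HasPath x y w`: there is a path from `x` to `y` in `G` whose edges have the sum `w`.
The empty path has weight `(≤, 0)`. -/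
inductive DistGraph.HasPath {X : Type*} (G : DistGraph X) :
    Option X → Option X → Weight → Prop
  | nil (x : Option X) : HasPath G x x (Weight.weak 0)
  | cons (x : Option X) {y z : Option X} {w : Weight} :
      HasPath G y z w → HasPath G x z (G x y + w)

/-- Canonical form: every edge weight is the greatest lower bound of the weights of the
paths between its end points. -/
def DistGraph.IsCanonical {X : Type*} (G : DistGraph X) : Prop :=
  ∀ x y, IsGLB {w | G.HasPath x y w} (G x y)

/-- `G` is the canonical distance graph of `Z`: it is in canonical form, it defines the set
`Z`, and the constraints `0 ≤ x` that hold for all clocks are among its constraints. -/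
structure DistGraph.IsCanonicalFor {X : Type*} (G : DistGraph X) (Z : Set (ClockValuation X)) :
    Prop where
  canonical : G.IsCanonical
  sem_eq : G.sem = Z
  nonneg : ∀ x : X, G (some x) none ≤ Weight.weak 0

/-- A bound function on the clocks, extended by the value `0` at the special clock `x₀`. -/
def extBound {X : Type*} (B : X → ℕ) : Option X → ℕ
  | none => 0
  | some x => B x

/-! ### Random access programs with a step count -/

/-- A state of the machine: integer registers and an integer memory. -/
structure State where
  reg : ℕ → ℤ
  mem : ℤ → ℤ

/-- The elementary instructions; the arguments are names of registers. -/
inductive Instr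
  /-- `r := c` -/
  | const (r : ℕ) (c : ℤ)
  /-- `r := a + b` -/
  | add (r a b : ℕ)
  /-- `r := a - b` -/
  | sub (r a b : ℕ)
  /-- `r := mem[a]` -/
  | load (r a : ℕ)
  /-- `mem[a] := b` -/
  | store (a b : ℕ)

/-- The effect of an elementary instruction. -/
def Instr.apply (s : State) : Instr → State
  | .const r c => { s with reg := Function.update s.reg r c }
  | .add r a b => { s with reg := Function.update s.reg r (s.reg a + s.reg b) }
  | .sub r a b => { s with reg := Function.update s.reg r (s.reg a - s.reg b) }
  | .load r a => { s with reg := Function.update s.reg r (s.mem (s.reg a)) }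
  | .store a b => { s with mem := Function.update s.mem (s.reg a) (s.reg b) }

/-- Structured programs; the tests compare two registers. -/
inductive Prog
  | skip
  | instr (i : Instr)
  | seq (p q : Prog)
  /-- `if a < b then p else q` -/
  | ifLt (a b : ℕ) (p q : Prog)
  /-- `while a < b do p` -/
  | whileLt (a b : ℕ) (p : Prog)

/-- `Exec p s s' t`: the program `p`, started in the state `s`, halts in the state `s'` after
`t` steps. Every elementary instruction and every evaluation of a test is one step. -/
inductive Exec : Prog → State → State → ℕ → Prop
  | skip (s : State) : Exec .skip s s 0
  | instr (i : Instr) (s : State) : Exec (.instr i) s (i.apply s) 1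
  | seq {p q : Prog} {s s' s'' : State} {t t' : ℕ} :
      Exec p s s' t → Exec q s' s'' t' → Exec (.seq p q) s s'' (t + t')
  | ifTrue {a b : ℕ} {p q : Prog} {s s' : State} {t : ℕ} :
      s.reg a < s.reg b → Exec p s s' t → Exec (.ifLt a b p q) s s' (t + 1)
  | ifFalse {a b : ℕ} {p q : Prog} {s s' : State} {t : ℕ} :
      ¬ s.reg a < s.reg b → Exec q s s' t → Exec (.ifLt a b p q) s s' (t + 1)
  | whileTrue {a b : ℕ} {p : Prog} {s s' s'' : State} {t t' : ℕ} :
      s.reg a < s.reg b → Exec p s s' t → Exec (.whileLt a b p) s' s'' t' →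
      Exec (.whileLt a b p) s s'' (t + t' + 1)
  | whileFalse {a b : ℕ} {p : Prog} {s : State} :
      ¬ s.reg a < s.reg b → Exec (.whileLt a b p) s s 1

/-- Programs are deterministic: final state and number of steps are unique. -/
theorem Exec.unique {p : Prog} {s s₁ s₂ : State} {t₁ t₂ : ℕ}
    (h₁ : Exec p s s₁ t₁) (h₂ : Exec p s s₂ t₂) : s₁ = s₂ ∧ t₁ = t₂ := by
  induction h₁ generalizing s₂ t₂ with
  | skip s => cases h₂; exact ⟨rfl, rfl⟩
  | instr i s => cases h₂; exact ⟨rfl, rfl⟩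
  | seq _ _ ih ih' =>
    cases h₂ with
    | seq k k' =>
      obtain ⟨rfl, rfl⟩ := ih k
      obtain ⟨rfl, rfl⟩ := ih' k'
      exact ⟨rfl, rfl⟩
  | ifTrue hc _ ih =>
    cases h₂ with
    | ifTrue _ k => obtain ⟨rfl, rfl⟩ := ih k; exact ⟨rfl, rfl⟩
    | ifFalse hn _ => exact absurd hc hn
  | ifFalse hn _ ih =>
    cases h₂ with
    | ifTrue hc _ => exact absurd hc hn
    | ifFalse _ k => obtain ⟨rfl, rfl⟩ := ih k; exact ⟨rfl, rfl⟩
  | whileTrue hc _ _ ih ih' =>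
    cases h₂ with
    | whileTrue _ k k' =>
      obtain ⟨rfl, rfl⟩ := ih k
      obtain ⟨rfl, rfl⟩ := ih' k'
      exact ⟨rfl, rfl⟩
    | whileFalse hn => exact absurd hc hn
  | whileFalse hn =>
    cases h₂ with
    | whileTrue hc _ _ => exact absurd hc hn
    | whileFalse _ => exact ⟨rfl, rfl⟩

/-! ### The input of the inclusion test -/

/-- The kind of a weight as a number: `0` for `(<, c)`, `1` for `(≤, c)`, `2` for `(<, ∞)`. -/
def Weight.kind : Weight → ℤ
  | .strict _ => 0
  | .weak _ => 1
  | .infty => 2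

/-- The bound of a weight, `0` for `(<, ∞)`. -/
def Weight.bound : Weight → ℤ
  | .strict c => c
  | .weak c => c
  | .infty => 0

/-- The number of a vertex: `x₀` is vertex `0`, the clock `i` is vertex `i + 1`. -/
def vertexNumber {n : ℕ} : Option (Fin n) → ℤ
  | none => 0
  | some i => (i : ℤ) + 1

/-- The weights of `G` are stored row by row from the address `base` on, two cells each. -/
def StoresGraph {n : ℕ} (s : State) (base : ℤ) (G : DistGraph (Fin n)) : Prop :=
  ∀ x y : Option (Fin n),
    s.mem (base + 2 * (((n : ℤ) + 1) * vertexNumber x + vertexNumber y)) = (G x y).kind ∧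
    s.mem (base + 2 * (((n : ℤ) + 1) * vertexNumber x + vertexNumber y) + 1) = (G x y).bound

/-- The memory of `s` holds, from the address `0` on, the number of clocks, the `L`-bounds,
the `U`-bounds, the graph `G` and the graph `G'`. Everything else is arbitrary. -/
structure StoresInput {n : ℕ} (s : State) (L U : Fin n → ℕ) (G G' : DistGraph (Fin n)) :
    Prop where
  size : s.mem 0 = (n : ℤ)
  lower : ∀ i : Fin n, s.mem (1 + (i : ℤ)) = (L i : ℤ)
  upper : ∀ i : Fin n, s.mem (1 + (n : ℤ) + (i : ℤ)) = (U i : ℤ)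
  graph : StoresGraph s (1 + 2 * (n : ℤ)) G
  graph' : StoresGraph s (1 + 2 * (n : ℤ) + 2 * ((n : ℤ) + 1) ^ 2) G'

end LUZone

open LUZone

/-! A weight is read as the set of reals obeying it, a non-empty lower set. The order of weights is
then inclusion and their addition is the Minkowski sum (`lt_iff_exists_holds`, `holds_add_iff`), so
a strict inequality between weights yields a real in one set and outside the other.

For a fixed `v`, some `v' ∈ Z'` with `v ≼ v'` exists iff the closed difference system `G'` has a
solution within unary bounds: `v' x ≤ v x` whenever `v x ≤ U x`, and `v' y ≥ v y` or `v' y > L y`.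
By `exists_potential`, such a system is solvable as soon as each upper bound is compatible with each
lower bound along the single edge joining them. Hence `v ∉ aLU L U Z'` is always caused by one pair
`x, y`. For `v ∈ Z` this pair gives the three inequalities of the criterion. Conversely, the
inequalities give differences that only bound other vertices relative to `x`; closedness of `G` lets
one `v ∈ Z` meet them all, again by `exists_potential`.

For the second part, the criterion is checked for all `(n + 1) ^ 2` pairs at constant cost each.
Finite weights are compared through the integer `2 * bound + kind`, and a loop invariant over the
pairs in row order gives correctness and the step count. -/

namespace LUZone

open scoped NNReal

/-! ### Weights as sets of reals -/

namespace Weight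

theorem Holds.mono {w : Weight} {d e : ℝ} (h : w.Holds e) (hde : d ≤ e) : w.Holds d := by
  cases w <;> simp only [Holds] at * <;> linarith

theorem exists_holds_le (w : Weight) (e : ℝ) : ∃ d ≤ e, w.Holds d := by
  cases w with
  | strict c => exact ⟨min e (c - 1), min_le_left _ _, (min_le_right _ _).trans_lt (by linarith)⟩
  | weak c => exact ⟨min e c, min_le_left _ _, min_le_right _ _⟩
  | infty => exact ⟨e, le_rfl, trivial⟩

/-- For two strict weights the slack `a + b - d` is split evenly; otherwise one summand can be
placed first and the other takes the rest. With `infty`, the non-emptiness of the other set is what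
matters. -/
theorem holds_add_iff {w₁ w₂ : Weight} {d : ℝ} :
    (w₁ + w₂).Holds d ↔ ∃ a b, w₁.Holds a ∧ w₂.Holds b ∧ a + b = d := by
  constructor
  · intro h
    change (Weight.add w₁ w₂).Holds d at h
    cases w₁ with
    | strict a =>
      cases w₂ with
      | strict b =>
        simp only [Weight.add, Holds, Int.cast_add] at h
        exact ⟨a - (a + b - d) / 2, b - (a + b - d) / 2, by simp only [Holds]; linarith,
          by simp only [Holds]; linarith, by ring⟩
      | weak b =>
        simp only [Weight.add, Holds, Int.cast_add] at h
        exact ⟨d - b, b, by simp only [Holds]; linarith, by simp only [Holds]; linarith, by ring⟩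
      | infty =>
        exact ⟨a - 1, d - (a - 1), by simp only [Holds]; linarith, trivial, by ring⟩
    | weak a =>
      cases w₂ with
      | infty => exact ⟨a, d - a, by simp only [Holds]; linarith, trivial, by ring⟩
      | _ b =>
        simp only [Weight.add, Holds, Int.cast_add] at h
        exact ⟨a, d - a, by simp only [Holds]; linarith, by simp only [Holds]; linarith, by ring⟩
    | infty =>
      obtain ⟨b, -, hb⟩ := exists_holds_le w₂ 0
      exact ⟨d - b, b, trivial, hb, by ring⟩
  · rintro ⟨a, b, ha, hb, rfl⟩
    change (Weight.add w₁ w₂).Holds _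
    cases w₁ <;> cases w₂ <;> simp only [Holds, Weight.add, Int.cast_add] at * <;> linarith

/-- Lower sets of reals form a chain, so a failing inclusion is witnessed by a separating real: the
midpoint of the two bounds if the larger weight is strict, its own bound if it is weak. -/
theorem lt_iff_exists_holds {w₁ w₂ : Weight} :
    w₁ < w₂ ↔ ∃ d, w₂.Holds d ∧ ¬ w₁.Holds d := by
  have le_iff : w₂ ≤ w₁ ↔ ∀ d, w₂.Holds d → w₁.Holds d := by
    change Weight.Le w₂ w₁ ↔ _
    cases w₂ with
    | strict a =>
      cases w₁ with
      | infty => simp [Weight.Le, Holds]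
      | _ b =>
        simp only [Weight.Le, Holds]
        refine ⟨fun h d hd => ?_, fun h => ?_⟩
        · have : (a : ℝ) ≤ b := by exact_mod_cast h
          linarith
        · by_contra! hab
          have hab' : (b : ℝ) < a := by exact_mod_cast hab
          have := h ((a + b) / 2) (by linarith)
          linarith
    | weak a =>
      cases w₁ with
      | infty => simp [Weight.Le, Holds]
      | _ b =>
        simp only [Weight.Le, Holds]
        refine ⟨fun h d hd => ?_, fun h => by exact_mod_cast h a le_rfl⟩
        first
          | exact hd.trans_lt (by exact_mod_cast h)
          | exact hd.trans (by exact_mod_cast h)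
    | infty =>
      cases w₁ with
      | infty => simp [Weight.Le, Holds]
      | _ b =>
        simp only [Weight.Le, Holds, false_iff]
        intro h
        have := h (b + 1) trivial
        linarith
  rw [← not_le, le_iff]
  push Not
  rfl

theorem le_iff_holds {w₁ w₂ : Weight} : w₁ ≤ w₂ ↔ ∀ d, w₁.Holds d → w₂.Holds d := by
  rw [← not_lt, lt_iff_exists_holds]
  push Not
  rfl

theorem weak_le_iff {c : ℤ} {w : Weight} : weak c ≤ w ↔ w.Holds c := by
  rw [le_iff_holds]
  exact ⟨fun h => h c le_rfl, fun h d hd => h.mono hd⟩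

end Weight

/-! ### Solutions of closed systems of difference constraints -/

/-- In a closed system of difference constraints, with an upper bound `Up x` and a lower bound
`Lo x` for every variable, pairwise compatibility suffices for solvability. -/
theorem exists_potential {V : Type*} [Finite V] (W : V → V → Set ℝ)
    (hW : ∀ x y, IsLowerSet (W x y)) (hrefl : ∀ x, W x x = Set.Iic 0)
    (htri : ∀ x y z, ∀ d ∈ W x z, ∃ a ∈ W x y, ∃ b ∈ W y z, a + b = d)
    (Up Lo : V → Set ℝ) (hUp : ∀ x, IsLowerSet (Up x)) (hLo : ∀ x, IsUpperSet (Lo x))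
    (hc : ∀ x y, ∃ u ∈ Up x, ∃ l ∈ Lo y, l - u ∈ W x y) :
    ∃ f : V → ℝ, (∀ x, f x ∈ Up x ∧ f x ∈ Lo x) ∧ ∀ x y, f y - f x ∈ W x y := by
  classical
  have := Fintype.ofFinite V
  -- The variables are fixed one at a time. Fixing `x` replaces its bounds by `Iic (f x)` and `Ici
  -- (f x)`; pairwise compatibility of the current bounds is the invariant.
  suffices H : ∀ S : Finset V, ∃ (f : V → ℝ),
      (∀ z ∈ S, f z ∈ Up z ∧ f z ∈ Lo z) ∧
      ∀ x y, ∃ u ∈ (if x ∈ S then Set.Iic (f x) else Up x),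
        ∃ l ∈ (if y ∈ S then Set.Ici (f y) else Lo y), l - u ∈ W x y by
    obtain ⟨f, hf, hc⟩ := H Finset.univ
    refine ⟨f, fun x => hf x (Finset.mem_univ x), fun x y => ?_⟩
    obtain ⟨u, hu, l, hl, h⟩ := hc x y
    simp only [Finset.mem_univ, if_true, Set.mem_Iic, Set.mem_Ici] at hu hl
    exact hW x y (by linarith : f y - f x ≤ l - u) h
  intro S
  induction S using Finset.induction_on with
  | empty => exact ⟨0, by simp, by simpa using hc⟩
  | insert z S hz ih =>
    obtain ⟨f, hf, hc⟩ := ih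
    set A : V → Set ℝ := fun x => if x ∈ S then Set.Iic (f x) else Up x with hA
    set B : V → Set ℝ := fun x => if x ∈ S then Set.Ici (f x) else Lo x with hB
    have hAl : ∀ x, IsLowerSet (A x) := fun x => by
      simp only [hA]; split_ifs; exacts [isLowerSet_Iic _, hUp x]
    have hBu : ∀ x, IsUpperSet (B x) := fun x => by
      simp only [hB]; split_ifs; exacts [isUpperSet_Ici _, hLo x]
    -- for every pair a value of `z` that is compatible with both bounds
    have key : ∀ x y, ∃ r, (∃ u ∈ A x, r - u ∈ W x z) ∧ ∃ l ∈ B y, l - r ∈ W z y := by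
      intro x y
      obtain ⟨u, hu, l, hl, h⟩ := hc x y
      obtain ⟨a, ha, b, hb, hab⟩ := htri x z y _ h
      exact ⟨u + a, ⟨u, hu, by simpa using ha⟩, l, hl, by
        have : l - (u + a) = b := by linarith
        rwa [this]⟩
    choose r hr1 hr2 using key
    have : Nonempty V := ⟨z⟩
    -- the minimum over `x` of the maximum over `y` is compatible with all of them
    obtain ⟨x₀, hx₀⟩ := Finite.exists_min (fun x => Finset.univ.sup' Finset.univ_nonempty (r x))
    set R := Finset.univ.sup' Finset.univ_nonempty (r x₀) with hR
    have hRA : ∀ x, ∃ u ∈ A x, R - u ∈ W x z := by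
      intro x
      obtain ⟨y, -, hy⟩ := Finset.exists_mem_eq_sup' Finset.univ_nonempty (r x)
      obtain ⟨u, hu, h⟩ := hr1 x y
      refine ⟨u, hu, hW x z ?_ h⟩
      have := hx₀ x
      rw [hy] at this
      linarith
    have hRB : ∀ y, ∃ l ∈ B y, l - R ∈ W z y := by
      intro y
      obtain ⟨l, hl, h⟩ := hr2 x₀ y
      refine ⟨l, hl, hW z y ?_ h⟩
      have : r x₀ y ≤ R := Finset.le_sup' (r x₀) (Finset.mem_univ y)
      linarith
    refine ⟨Function.update f z R, fun x hx => ?_, fun x y => ?_⟩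
    · rcases eq_or_ne x z with rfl | hxz
      · obtain ⟨u, hu, h⟩ := hRA x
        obtain ⟨l, hl, h'⟩ := hRB x
        -- Since `W z z = Iic 0`, compatibility of `z` with itself says that `R` lies between its
        -- own bounds.
        simp only [hrefl, Set.mem_Iic] at h h'
        have hu' := hAl x (by linarith : R ≤ u) hu
        have hl' := hBu x (by linarith : l ≤ R) hl
        simp only [hA, hB, hz, if_false] at hu' hl'
        simpa using ⟨hu', hl'⟩
      · simpa [hxz] using hf x ((Finset.mem_insert.1 hx).resolve_left hxz)
    · have e1 : ∀ x ≠ z, (if x ∈ insert z S then Set.Iic (Function.update f z R x) else Up x)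
          = A x := fun x hx => by simp [hA, hx]
      have e2 : ∀ x ≠ z, (if x ∈ insert z S then Set.Ici (Function.update f z R x) else Lo x)
          = B x := fun x hx => by simp [hB, hx]
      rcases eq_or_ne x z with hx | hx <;> rcases eq_or_ne y z with hy | hy
      · subst hx hy
        have h0 : R - R ∈ W y y := by simp [hrefl]
        exact ⟨R, by simp, R, by simp, h0⟩
      · subst hx
        rw [e2 y hy]
        exact ⟨R, by simp, hRB y⟩
      · subst hy
        rw [e1 x hx]
        obtain ⟨u, hu, h⟩ := hRA x
        exact ⟨u, hu, R, by simp, h⟩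
      · rw [e1 x hx, e2 y hy]
        exact hc x y

/-! ### Canonical distance graphs -/

namespace DistGraph

variable {X : Type*} {G : DistGraph X} {Z : Set (ClockValuation X)}

theorem IsCanonicalFor.holds (h : G.IsCanonicalFor Z) {v : ClockValuation X} (hv : v ∈ Z)
    (x y : Option X) : (G x y).Holds (vertexValue v y - vertexValue v x) := by
  rw [← h.sem_eq] at hv
  exact hv x y

theorem IsCanonicalFor.refl (h : G.IsCanonicalFor Z) (hZ : Z.Nonempty) (x : Option X) :
    G x x = Weight.weak 0 := by
  obtain ⟨v, hv⟩ := hZ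
  refine le_antisymm ((h.canonical x x).1 (HasPath.nil x)) ?_
  rw [Weight.weak_le_iff]
  simpa using h.holds hv x x

theorem IsCanonicalFor.triangle (h : G.IsCanonicalFor Z) (x y z : Option X) (d : ℝ)
    (hd : (G x z).Holds d) : ∃ a, (G x y).Holds a ∧ ∃ b, (G y z).Holds b ∧ a + b = d := by
  have := (h.canonical x z).1 (HasPath.cons x (HasPath.cons y (HasPath.nil z)))
  obtain ⟨a, b, ha, hb, rfl⟩ := Weight.holds_add_iff.1 (Weight.le_iff_holds.1 this d hd)
  obtain ⟨b, c, hb', hc, rfl⟩ := Weight.holds_add_iff.1 hb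
  simp only [Weight.Holds, Int.cast_zero] at hc
  -- The empty path at the end contributes `c ≤ 0`, which the lower set of `G y z` absorbs.
  exact ⟨a, ha, b + c, hb'.mono (by linarith), rfl⟩

/-- This makes every weight into `x₀` finite, so the program need not test it for `infty`. -/
theorem IsCanonicalFor.le_zero (h : G.IsCanonicalFor Z) (hZ : Z.Nonempty) (x : Option X) :
    G x none ≤ Weight.weak 0 := by
  cases x with
  | none => exact (h.refl hZ none).le
  | some x => exact h.nonneg x

/-- A non-empty zone contains a valuation that meets pairwise compatible bounds, up to a
translation by the value of the special clock. -/
theorem IsCanonicalFor.exists_mem [Finite X] (h : G.IsCanonicalFor Z) (hZ : Z.Nonempty)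
    (Up Lo : Option X → Set ℝ) (hUp : ∀ x, IsLowerSet (Up x)) (hLo : ∀ x, IsUpperSet (Lo x))
    (hc : ∀ x y, ∃ u ∈ Up x, ∃ l ∈ Lo y, (G x y).Holds (l - u)) :
    ∃ v ∈ Z, ∃ r : ℝ, ∀ x, vertexValue v x + r ∈ Up x ∧ vertexValue v x + r ∈ Lo x := by
  obtain ⟨f, hf, hG⟩ := exists_potential (fun x y => {d | (G x y).Holds d})
    (fun x y a b hab ha => Weight.Holds.mono ha hab)
    (fun x => by ext d; simp [h.refl hZ, Weight.Holds])
    (fun x y z d hd => h.triangle x y z d hd) Up Lo hUp hLo hc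
  have hpos : ∀ x : X, 0 ≤ f (some x) - f none := fun x => by
    have := Weight.le_iff_holds.1 (h.nonneg x) _ (hG (some x) none)
    simp only [Weight.Holds, Int.cast_zero] at this
    linarith
  let v : ClockValuation X := fun x => ⟨f (some x) - f none, hpos x⟩
  have hv : ∀ x, vertexValue v x + f none = f x := by
    rintro (_ | x)
    · simp [vertexValue]
    · exact sub_add_cancel _ _
  refine ⟨v, ?_, f none, fun x => by rw [hv]; exact hf x⟩
  rw [← h.sem_eq]
  intro x y
  have := hG x y
  rw [← hv x, ← hv y] at this
  simpa using this

end DistGraph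

/-! ### The inclusion test -/

variable {X : Type*}

/-- The condition of the inclusion test for the pair `x, y`. -/
def Refutes (L U : X → ℕ) (G G' : DistGraph X) (x y : Option X) : Prop :=
  Weight.weak (-(extBound U x : ℤ)) ≤ G x none ∧ G' x y < G x y ∧
    G' x y + Weight.strict (-(extBound L y : ℤ)) < G x none

/-- Both implications are vacuous at `x₀`, whose value is always `0`, so all vertices can be treated
alike. -/
theorem luPreorder_iff {L U : X → ℕ} {v v' : ClockValuation X} :
    LUPreorder L U v v' ↔ ∀ x : Option X,
      (vertexValue v' x < vertexValue v x → (extBound L x : ℝ) < vertexValue v' x) ∧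
      (vertexValue v x < vertexValue v' x → (extBound U x : ℝ) < vertexValue v x) := by
  have key : ∀ x : X, ((v' x < v x → (L x : ℝ≥0) < v' x) ∧ (v x < v' x → (U x : ℝ≥0) < v x)) ↔
      (((v' x : ℝ) < v x → (L x : ℝ) < v' x) ∧ ((v x : ℝ) < v' x → (U x : ℝ) < v x)) := by
    intro x
    rw [← NNReal.coe_lt_coe, ← NNReal.coe_lt_coe, ← NNReal.coe_lt_coe, ← NNReal.coe_lt_coe]
    simp
  constructor
  · rintro h (_ | x)
    · simp [vertexValue]
    · exact (key x).1 (h x)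
  · intro h x
    exact (key x).2 (h (some x))

/-- Failure of membership in the abstraction is witnessed by one pair of vertices. -/
theorem exists_of_notMem_aLU [Finite X] {L U : X → ℕ} {Z' : Set (ClockValuation X)}
    {G' : DistGraph X} (h' : G'.IsCanonicalFor Z') (hZ' : Z'.Nonempty) {v : ClockValuation X}
    (hv : v ∉ aLU L U Z') :
    ∃ x y : Option X, vertexValue v x ≤ extBound U x ∧
      ¬ (G' x y).Holds (vertexValue v y - vertexValue v x) ∧
      ∀ l : ℝ, extBound L y < l → ¬ (G' x y).Holds (l - vertexValue v x) := by
  by_contra! H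
  apply hv
  -- The chosen bounds express `v ≼ v'` vertex by vertex; a vertex above its `U`-bound has no upper
  -- bound.
  obtain ⟨v', hv', r, hr⟩ := h'.exists_mem hZ'
    (fun x => {u | vertexValue v x ≤ extBound U x → u ≤ vertexValue v x})
    (fun y => {l | vertexValue v y ≤ l ∨ extBound L y < l})
    (fun x a b hab ha h => hab.trans (ha h))
    (fun y a b hab ha => ha.imp (fun h => h.trans hab) (fun h => h.trans_le hab))
    (fun x y => by
      by_cases hx : vertexValue v x ≤ extBound U x
      · by_cases hxy : (G' x y).Holds (vertexValue v y - vertexValue v x)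
        · exact ⟨_, fun _ => le_rfl, _, Or.inl le_rfl, hxy⟩
        · obtain ⟨l, hl, hl'⟩ := H x y hx hxy
          exact ⟨_, fun _ => le_rfl, l, Or.inr hl, hl'⟩
      · obtain ⟨d, -, hd⟩ := (G' x y).exists_holds_le 0
        exact ⟨vertexValue v y - d, fun h => absurd h hx, vertexValue v y, Or.inl le_rfl,
          by simpa using hd⟩)
  -- At `x₀` the bounds are `r ≤ 0` and `0 ≤ r ∨ 0 < r`, which removes the translation.
  have hr0 : r = 0 := by
    obtain ⟨h1, h2⟩ := hr none
    simp only [vertexValue, extBound, Set.mem_ofPred_eq, Nat.cast_zero, zero_add, le_refl,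
      forall_const] at h1 h2
    rcases h2 with h2 | h2 <;> linarith
  subst hr0
  simp only [add_zero, Set.mem_ofPred_eq] at hr
  refine ⟨v', hv', luPreorder_iff.2 fun x => ⟨fun hlt => ?_, fun hlt => ?_⟩⟩
  · exact (hr x).2.resolve_left hlt.not_ge
  · by_contra! hle
    exact absurd ((hr x).1 hle) hlt.not_ge

/-- A simulating `v'` has `v' x ≤ v x`, while `v' y` is at least `v y` or exceeds `L y`. Either way
`v' y - v' x` is at least a difference that `G' x y` forbids. -/
theorem notMem_aLU_of_refuted {L U : X → ℕ} {Z' : Set (ClockValuation X)}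
    {G' : DistGraph X} (h' : G'.IsCanonicalFor Z') {v : ClockValuation X} {x y : Option X}
    (hx : vertexValue v x ≤ extBound U x)
    (hxy : ¬ (G' x y).Holds (vertexValue v y - vertexValue v x))
    (hl : ∀ l : ℝ, extBound L y < l → ¬ (G' x y).Holds (l - vertexValue v x)) :
    v ∉ aLU L U Z' := by
  rintro ⟨v', hv', hle⟩
  rw [luPreorder_iff] at hle
  have hG := h'.holds hv' x y
  have hx' : vertexValue v' x ≤ vertexValue v x := by
    by_contra! h
    exact absurd ((hle x).2 h) hx.not_gt
  rcases lt_or_ge (vertexValue v' y) (vertexValue v y) with h | h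
  · exact hl _ ((hle y).1 h) (hG.mono (by linarith))
  · exact hxy (hG.mono (by linarith))

theorem not_subset_aLU_iff [Finite X] {L U : X → ℕ} {Z Z' : Set (ClockValuation X)}
    {G G' : DistGraph X} (hZ : Z.Nonempty) (hZ' : Z'.Nonempty)
    (h : G.IsCanonicalFor Z) (h' : G'.IsCanonicalFor Z') :
    ¬ Z ⊆ aLU L U Z' ↔ ∃ x y, Refutes L U G G' x y := by
  rw [Set.not_subset]
  constructor
  · rintro ⟨v, hv, hva⟩
    obtain ⟨x, y, hx, hxy, hl⟩ := exists_of_notMem_aLU h' hZ' hva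
    have h0 : (G x none).Holds (-vertexValue v x) := by
      simpa [vertexValue] using h.holds hv x none
    refine ⟨x, y, Weight.weak_le_iff.2 (h0.mono ?_),
      Weight.lt_iff_exists_holds.2 ⟨_, h.holds hv x y, hxy⟩,
      Weight.lt_iff_exists_holds.2 ⟨_, h0, fun hs => ?_⟩⟩
    · push_cast
      linarith
    · obtain ⟨a, b, ha, hb, hab⟩ := Weight.holds_add_iff.1 hs
      simp only [Weight.Holds, Int.cast_neg, Int.cast_natCast] at hb
      exact hl (-b) (by linarith) (ha.mono (by linarith))
  · rintro ⟨x, y, hU, hlt, hL⟩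
    obtain ⟨d₁, hd₁, hd₁'⟩ := Weight.lt_iff_exists_holds.1 hlt
    obtain ⟨d₂, hd₂, hd₂'⟩ := Weight.lt_iff_exists_holds.1 hL
    rw [Weight.weak_le_iff] at hU
    push_cast at hU
    -- The valuation is translated so that `x` sits at `0`. Only `x` has an upper bound; the lower
    -- bounds ask that `-v x` be at least `-U x` and `d₂`, and that `v y - v x` be at least `d₁`.
    obtain ⟨v, hv, r, hr⟩ := h.exists_mem hZ (fun a => {u | a = x → u ≤ 0})
      (fun b => {l | (b = x → 0 ≤ l) ∧ (b = none → -(extBound U x : ℝ) ≤ l ∧ d₂ ≤ l) ∧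
        (b = y → d₁ ≤ l)})
      (fun a u u' huu' hu e => huu'.trans (hu e))
      (fun b l l' hll' hl => ⟨fun e => (hl.1 e).trans hll',
        fun e => ⟨(hl.2.1 e).1.trans hll', (hl.2.1 e).2.trans hll'⟩,
        fun e => (hl.2.2 e).trans hll'⟩)
      (fun a b => by
        rcases eq_or_ne a x with rfl | ha
        -- The vertices `x`, `y`, `x₀` may coincide, so `b` may carry several lower bounds. Each is
        -- compatible by itself, hence so is their maximum.
        · have glue : ∀ {p q : ℝ}, (G a b).Holds p → (G a b).Holds q →
              (G a b).Holds (max p q) := fun {p q} hp hq => by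
            rcases max_choice p q with e | e <;> rwa [e]
          have h1 : ∃ l, (G a b).Holds l ∧ (b = a → 0 ≤ l) := by
            by_cases e : b = a
            · subst e
              exact ⟨0, by simp [h.refl hZ, Weight.Holds], fun _ => le_rfl⟩
            · obtain ⟨l, -, hl⟩ := (G a b).exists_holds_le 0
              exact ⟨l, hl, fun e' => absurd e' e⟩
          have h2 : ∃ l, (G a b).Holds l ∧
              (b = none → -(extBound U a : ℝ) ≤ l ∧ d₂ ≤ l) := by
            by_cases e : b = none
            · subst e
              exact ⟨_, glue hU hd₂, fun _ => ⟨le_max_left _ _, le_max_right _ _⟩⟩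
            · obtain ⟨l, -, hl⟩ := (G a b).exists_holds_le 0
              exact ⟨l, hl, fun e' => absurd e' e⟩
          have h3 : ∃ l, (G a b).Holds l ∧ (b = y → d₁ ≤ l) := by
            by_cases e : b = y
            · subst e
              exact ⟨_, hd₁, fun _ => le_rfl⟩
            · obtain ⟨l, -, hl⟩ := (G a b).exists_holds_le 0
              exact ⟨l, hl, fun e' => absurd e' e⟩
          obtain ⟨l₁, hl₁, h1⟩ := h1
          obtain ⟨l₂, hl₂, h2⟩ := h2
          obtain ⟨l₃, hl₃, h3⟩ := h3
          refine ⟨0, fun _ => le_rfl, max l₁ (max l₂ l₃), ⟨fun e => ?_, fun e => ⟨?_, ?_⟩,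
            fun e => ?_⟩, by simpa only [sub_zero] using glue hl₁ (glue hl₂ hl₃)⟩
          · exact (h1 e).trans (by simp)
          · exact (h2 e).1.trans (by simp)
          · exact (h2 e).2.trans (by simp)
          · exact (h3 e).trans (by simp)
        · let l := max 0 (max (-(extBound U x : ℝ)) (max d₁ d₂))
          obtain ⟨d, -, hd⟩ := (G a b).exists_holds_le 0
          refine ⟨l - d, fun e => absurd e ha, l, ⟨fun e => ?_, fun e => ⟨?_, ?_⟩,
            fun e => ?_⟩, by simpa using hd⟩ <;> simp [l])
    have hx := hr x
    have h0 := (hr none).2.2.1 rfl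
    have hy := (hr y).2.2.2 rfl
    have hx1 := hx.1 rfl
    have hx2 := hx.2.1 rfl
    simp only [vertexValue, zero_add] at h0
    have hrx : vertexValue v x = -r := by linarith
    refine ⟨v, hv, notMem_aLU_of_refuted h' (x := x) (y := y) (by linarith)
      (fun hG => hd₁' (hG.mono (by linarith))) fun l hl hG => hd₂' ?_⟩
    -- From `d₂ ≤ -v x` and `l > L y`, the second summand is below `-L y`, contrary to the choice of
    -- `d₂`.
    refine Weight.holds_add_iff.2 ⟨l - vertexValue v x, d₂ - (l - vertexValue v x), hG, ?_,
      by ring⟩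
    simp only [Weight.Holds, Int.cast_neg, Int.cast_natCast]
    linarith


/-! ### Reasoning about programs -/

/-- The sequence of a list of instructions. -/
def Prog.ofList : List Instr → Prog
  | [] => .skip
  | i :: l => .seq (.instr i) (Prog.ofList l)

/-- `Triple P p T Q`: started in a state with `P`, the program `p` halts after at most `T` steps
in a state with `Q`. -/
def Triple (P : State → Prop) (p : Prog) (T : ℕ) (Q : State → Prop) : Prop :=
  ∀ s, P s → ∃ s' t, Exec p s s' t ∧ t ≤ T ∧ Q s'

namespace Triple

variable {P Q R : State → Prop} {p q : Prog} {T T' : ℕ}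

theorem skip (h : ∀ s, P s → Q s) : Triple P .skip 0 Q :=
  fun s hs => ⟨s, 0, .skip s, le_rfl, h s hs⟩

theorem seq (hp : Triple P p T Q) (hq : Triple Q q T' R) : Triple P (.seq p q) (T + T') R := by
  intro s hs
  obtain ⟨s', t, h, ht, hs'⟩ := hp s hs
  obtain ⟨s'', t', h', ht', hs''⟩ := hq s' hs'
  exact ⟨s'', t + t', .seq h h', add_le_add ht ht', hs''⟩

theorem ofList (l : List Instr) (h : ∀ s, P s → Q (l.foldl Instr.apply s)) :
    Triple P (.ofList l) l.length Q := by
  induction l generalizing P with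
  | nil => exact skip h
  | cons i l ih =>
    have h1 : Triple P (.instr i) 1 (fun s' => ∃ s, P s ∧ s' = i.apply s) :=
      fun s hs => ⟨_, 1, .instr i s, le_rfl, s, hs, rfl⟩
    have h2 := h1.seq (ih (P := fun s' => ∃ s, P s ∧ s' = i.apply s) (by
      rintro _ ⟨s, hs, rfl⟩
      exact h s hs))
    rwa [add_comm] at h2

theorem ifLt {a b : ℕ} (hp : Triple (fun s => P s ∧ s.reg a < s.reg b) p T Q)
    (hq : Triple (fun s => P s ∧ ¬ s.reg a < s.reg b) q T' Q) :
    Triple P (.ifLt a b p q) (max T T' + 1) Q := by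
  intro s hs
  by_cases hc : s.reg a < s.reg b
  · obtain ⟨s', t, h, ht, hs'⟩ := hp s ⟨hs, hc⟩
    exact ⟨s', t + 1, .ifTrue hc h, by omega, hs'⟩
  · obtain ⟨s', t, h, ht, hs'⟩ := hq s ⟨hs, hc⟩
    exact ⟨s', t + 1, .ifFalse hc h, by omega, hs'⟩

/-- `I k` describes the state after `k` rounds. There are exactly `m` rounds and `m + 1` tests. -/
theorem whileLt {a b : ℕ} (m : ℕ) (I : ℕ → State → Prop)
    (hlt : ∀ k s, I k s → (s.reg a < s.reg b ↔ k < m))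
    (hp : ∀ k < m, Triple (I k) p T (I (k + 1))) :
    Triple (I 0) (.whileLt a b p) (m * (T + 1) + 1) (I m) := by
  have key : ∀ j k, k + j = m → Triple (I k) (.whileLt a b p) (j * (T + 1) + 1) (I m) := by
    intro j
    induction j with
    | zero =>
      rintro k hk s hs
      obtain rfl : k = m := hk
      exact ⟨s, 1, .whileFalse (by rw [hlt k s hs]; omega), by omega, hs⟩
    | succ j ih =>
      rintro k hk s hs
      obtain ⟨s', t, h, ht, hs'⟩ := hp k (by omega) s hs
      obtain ⟨s'', t', h', ht', hs''⟩ := ih (k + 1) (by omega) s' hs'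
      exact ⟨s'', t + t' + 1, .whileTrue ((hlt k s hs).2 (by omega)) h h', by
        rw [add_mul]; omega, hs''⟩
  exact key m 0 (zero_add m)

end Triple

/-! ### Comparison of weights by their numbers -/

namespace Weight

theorem kind_lt_two {w : Weight} : w.kind < 2 ↔ w ≠ infty := by
  cases w <;> simp [kind]

/-- Sending `(<, c)` to `2c` and `(≤, c)` to `2c + 1` embeds the order of the finite weights into
the integers. -/
theorem lt_iff_kind {w₁ w₂ : Weight} : w₁ < w₂ ↔
    w₁.kind < 2 ∧ (w₂.kind < 2 → 2 * w₁.bound + w₁.kind < 2 * w₂.bound + w₂.kind) := by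
  rw [← not_le]
  change ¬ Weight.Le w₂ w₁ ↔ _
  cases w₁ <;> cases w₂ <;> simp only [Weight.Le, kind, bound] <;> grind

theorem weak_le_iff_kind {c : ℤ} {w : Weight} (hw : w.kind < 2) :
    weak c ≤ w ↔ 2 * c + 1 ≤ 2 * w.bound + w.kind := by
  have hk : (weak c).kind = 1 := rfl
  have hb : (weak c).bound = c := rfl
  rw [← not_lt, lt_iff_kind, hk, hb]
  omega

theorem add_strict_lt_iff_kind {c : ℤ} {w₁ w₂ : Weight} (h₁ : w₁.kind < 2) (h₂ : w₂.kind < 2) :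
    w₁ + strict c < w₂ ↔ 2 * (w₁.bound + c) < 2 * w₂.bound + w₂.kind := by
  have h : (w₁ + strict c).kind = 0 ∧ (w₁ + strict c).bound = w₁.bound + c := by
    cases w₁ with
    | infty => exact absurd h₁ (lt_irrefl 2)
    | _ => exact ⟨rfl, rfl⟩
  rw [lt_iff_kind, h.1, h.2]
  omega

end Weight

/-! ### The program -/

/-- The start of the program: register `1` receives the number of vertices, and register `5`
is cleared. -/
def initList : List Instr :=
  [.const 8 0, .const 7 1, .const 9 2, .const 0 1, .load 10 8, .add 1 10 7, .const 2 0,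
    .const 3 0, .const 11 0, .const 5 0]

/-- The registers `4`, `5`, `6` receive the addresses of the two graphs. -/
def addressList : List Instr :=
  [.add 4 10 10, .add 4 4 7, .add 5 5 5, .add 5 5 4, .add 6 4 8]

/-- The weights for the pair in the registers `2`, `3` are loaded. -/
def loadList : List Instr :=
  [.load 11 4, .add 20 4 7, .load 12 20, .load 13 5, .add 20 5 7, .load 14 20,
    .load 15 6, .add 20 6 7, .load 16 20]

/-- The numbers that the test compares are computed. -/
def keyList : List Instr :=
  [.add 19 12 12, .add 19 19 11, .add 20 14 14, .add 20 20 13, .add 21 16 16, .add 21 21 15,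
    .sub 22 7 17, .sub 22 22 17, .sub 23 14 18, .add 23 23 23]

/-- The `U`-bound of clock `i` has address `1 + n + i`, which is `n` plus its vertex number; `x₀`
gets `0`. -/
def upperProg : Prog :=
  .ifLt 8 2 (.ofList [.add 20 10 2, .load 17 20]) (.ofList [.const 17 0])

def lowerProg : Prog :=
  .ifLt 8 3 (.ofList [.load 18 3]) (.ofList [.const 18 0])

/-- Register `22` holds the code `1 - 2U` of `(≤, -U)`, and register `23` the code of the strict sum
with `(<, -L)`. -/
def boundTest : Prog :=
  .ifLt 21 22 .skip (.ifLt 23 21 (.ofList [.const 0 0]) .skip)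

/-- An infinite weight in `G'` never refutes; an infinite weight in `G` exceeds every finite one, so
the comparison of codes is skipped. -/
def pairTest : Prog :=
  .ifLt 13 9 (.ifLt 11 9 (.ifLt 20 19 boundTest .skip) boundTest) .skip

/-- The registers `2`, `3` proceed to the next pair. -/
def advanceProg : Prog :=
  .seq (.ofList [.add 3 3 7, .add 4 4 9, .add 5 5 9])
    (.ifLt 3 1 .skip (.ofList [.const 3 0, .add 2 2 7, .add 6 4 8]))

def pairProg : Prog :=
  .seq (.ofList loadList) (.seq upperProg (.seq lowerProg (.seq (.ofList keyList)
    (.seq pairTest advanceProg))))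

/-- The inclusion test. -/
def inclusionProg : Prog :=
  -- Without multiplication, `(n + 1) ^ 2` is obtained by adding `n + 1` to itself in a loop.
  .seq (.ofList initList) (.seq (.whileLt 11 1 (.ofList [.add 5 5 1, .add 11 11 7]))
    (.seq (.ofList addressList) (.whileLt 2 1 pairProg)))

/-! ### Correctness and running time of the program -/

section Correctness

variable {n : ℕ}

theorem vertexNumber_nonneg (a : Option (Fin n)) : 0 ≤ vertexNumber a := by
  cases a <;> simp [vertexNumber]; omega

theorem vertexNumber_le (a : Option (Fin n)) : vertexNumber a ≤ n := by
  cases a with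
  | none => simp [vertexNumber]
  | some i => simp only [vertexNumber]; omega

theorem vertexNumber_injective : Function.Injective (vertexNumber (n := n)) := by
  rintro (_ | i) (_ | j) h <;> simp only [vertexNumber] at h
  · rfl
  · omega
  · omega
  · congr 1; ext; omega

theorem exists_vertexNumber_eq {i : ℕ} (hi : i ≤ n) :
    ∃ a : Option (Fin n), vertexNumber a = i := by
  cases i with
  | zero => exact ⟨none, rfl⟩
  | succ i => exact ⟨some ⟨i, hi⟩, by simp [vertexNumber]⟩

/-- The position of a pair in the rows of a graph. -/
def pairNumber (a b : Option (Fin n)) : ℤ := ((n : ℤ) + 1) * vertexNumber a + vertexNumber b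

/-- Uniqueness of division by `n + 1` with remainder, as vertex numbers lie between `0` and `n`. -/
theorem pairNumber_injective {a b a' b' : Option (Fin n)}
    (h : pairNumber a b = pairNumber a' b') : a = a' ∧ b = b' := by
  unfold pairNumber at h
  have h1 := vertexNumber_nonneg b
  have h2 := vertexNumber_nonneg b'
  have h3 := vertexNumber_le b
  have h4 := vertexNumber_le b'
  have ha : vertexNumber a = vertexNumber a' := by
    rcases lt_trichotomy (vertexNumber a) (vertexNumber a') with hlt | heq | hlt
    · nlinarith
    · exact heq
    · nlinarith
  rw [ha] at h
  exact ⟨vertexNumber_injective ha, vertexNumber_injective (by linarith)⟩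

theorem pairNumber_lt (a b : Option (Fin n)) : pairNumber a b < ((n : ℤ) + 1) ^ 2 := by
  unfold pairNumber
  have h1 := vertexNumber_le a
  have h2 := vertexNumber_le b
  nlinarith

theorem refutes_iff_kind {L U : Fin n → ℕ} {G G' : DistGraph (Fin n)} {a b : Option (Fin n)}
    (h : (G a none).kind < 2) :
    Refutes L U G G' a b ↔ (G' a b).kind < 2 ∧
      ((G a b).kind < 2 →
        2 * (G' a b).bound + (G' a b).kind < 2 * (G a b).bound + (G a b).kind) ∧
      ¬ 2 * (G a none).bound + (G a none).kind < 1 - 2 * (extBound U a : ℤ) ∧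
      2 * ((G' a b).bound - extBound L b) < 2 * (G a none).bound + (G a none).kind := by
  rw [Refutes, Weight.weak_le_iff_kind h, Weight.lt_iff_kind]
  by_cases h' : (G' a b).kind < 2
  · rw [Weight.add_strict_lt_iff_kind h' h]
    omega
  · simp [h']

variable (s₀ : State) (L U : Fin n → ℕ) (G G' : DistGraph (Fin n))

/-- The registers and the memory cells that are constant in the loops. -/
structure Ready (n : ℕ) (s₀ s : State) : Prop where
  mem : s.mem = s₀.mem
  size : s.reg 1 = (n : ℤ) + 1
  one : s.reg 7 = 1
  zero : s.reg 8 = 0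
  two : s.reg 9 = 2
  clocks : s.reg 10 = n

/-- The registers point to the cells in row `x` and column `y`. -/
structure AtCell (n : ℕ) (s₀ : State) (x y : ℤ) (s : State) : Prop extends Ready n s₀ s where
  row : s.reg 2 = x
  col : s.reg 3 = y
  cell : s.reg 4 = 1 + 2 * (n : ℤ) + 2 * (((n : ℤ) + 1) * x + y)
  cell' : s.reg 5 = 1 + 2 * (n : ℤ) + 2 * ((n : ℤ) + 1) ^ 2 + 2 * (((n : ℤ) + 1) * x + y)
  first : s.reg 6 = 1 + 2 * (n : ℤ) + 2 * (((n : ℤ) + 1) * x)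

variable {s₀} in
theorem AtCell.of_eq {x y : ℤ} {s s' : State} (h : AtCell n s₀ x y s) (hm : s'.mem = s.mem)
    (hr : ∀ r, 0 < r → r < 11 → s'.reg r = s.reg r) : AtCell n s₀ x y s' where
  mem := hm.trans h.mem
  size := (hr 1 (by norm_num) (by norm_num)).trans h.size
  one := (hr 7 (by norm_num) (by norm_num)).trans h.one
  zero := (hr 8 (by norm_num) (by norm_num)).trans h.zero
  two := (hr 9 (by norm_num) (by norm_num)).trans h.two
  clocks := (hr 10 (by norm_num) (by norm_num)).trans h.clocks
  row := (hr 2 (by norm_num) (by norm_num)).trans h.row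
  col := (hr 3 (by norm_num) (by norm_num)).trans h.col
  cell := (hr 4 (by norm_num) (by norm_num)).trans h.cell
  cell' := (hr 5 (by norm_num) (by norm_num)).trans h.cell'
  first := (hr 6 (by norm_num) (by norm_num)).trans h.first

/-- Register `0` tells whether one of the first `k` pairs refutes the inclusion. -/
def Answer (k : ℤ) (s : State) : Prop :=
  ((∃ a b, pairNumber a b < k ∧ Refutes L U G G' a b) → s.reg 0 = 0) ∧
    ((¬ ∃ a b, pairNumber a b < k ∧ Refutes L U G G' a b) → s.reg 0 = 1)

variable {s₀ L U G G'}

theorem Answer.of_eq {k : ℤ} {s s' : State} (h : Answer L U G G' k s) (hr : s'.reg 0 = s.reg 0) :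
    Answer L U G G' k s' := by
  rwa [Answer, hr]

theorem answer_succ_of_refutes {a b : Option (Fin n)} {s : State} (hab : Refutes L U G G' a b)
    (hs : s.reg 0 = 0) : Answer L U G G' (pairNumber a b + 1) s :=
  ⟨fun _ => hs, fun h => absurd ⟨a, b, lt_add_one _, hab⟩ h⟩

theorem Answer.succ {a b : Option (Fin n)} {s : State} (h : Answer L U G G' (pairNumber a b) s)
    (hab : ¬ Refutes L U G G' a b) : Answer L U G G' (pairNumber a b + 1) s := by
  have key : (∃ c d, pairNumber c d < pairNumber a b + 1 ∧ Refutes L U G G' c d) ↔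
      ∃ c d, pairNumber c d < pairNumber a b ∧ Refutes L U G G' c d := by
    refine ⟨?_, fun ⟨c, d, hcd, hr⟩ => ⟨c, d, by omega, hr⟩⟩
    rintro ⟨c, d, hcd, hr⟩
    rcases (Int.lt_add_one_iff.1 hcd).lt_or_eq with hlt | heq
    · exact ⟨c, d, hlt, hr⟩
    · obtain ⟨rfl, rfl⟩ := pairNumber_injective heq
      exact absurd hr hab
  rwa [Answer, key]

/-- The state in which the pair `a, b` is treated and the pairs before it have been treated. -/
def Treats (s₀ : State) (L U : Fin n → ℕ) (G G' : DistGraph (Fin n)) (a b : Option (Fin n))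
    (s : State) : Prop :=
  AtCell n s₀ (vertexNumber a) (vertexNumber b) s ∧ Answer L U G G' (pairNumber a b) s

theorem Treats.of_eq {a b : Option (Fin n)} {s s' : State} (h : Treats s₀ L U G G' a b s)
    (hm : s'.mem = s.mem) (hr : ∀ r < 11, s'.reg r = s.reg r) : Treats s₀ L U G G' a b s' :=
  ⟨h.1.of_eq hm fun r _ => hr r, h.2.of_eq (hr 0 (by norm_num))⟩

/-- The weights for the pair `a, b` have been loaded. -/
structure Loaded (s₀ : State) (L U : Fin n → ℕ) (G G' : DistGraph (Fin n))
    (a b : Option (Fin n)) (s : State) : Prop where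
  treats : Treats s₀ L U G G' a b s
  kind : s.reg 11 = (G a b).kind
  bound : s.reg 12 = (G a b).bound
  kind' : s.reg 13 = (G' a b).kind
  bound' : s.reg 14 = (G' a b).bound
  kind₀ : s.reg 15 = (G a none).kind
  bound₀ : s.reg 16 = (G a none).bound

theorem Loaded.of_eq {a b : Option (Fin n)} {s s' : State} (h : Loaded s₀ L U G G' a b s)
    (hm : s'.mem = s.mem) (hr : ∀ r < 17, s'.reg r = s.reg r) : Loaded s₀ L U G G' a b s' where
  treats := h.treats.of_eq hm fun r hr' => hr r (by omega)
  kind := (hr 11 (by norm_num)).trans h.kind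
  bound := (hr 12 (by norm_num)).trans h.bound
  kind' := (hr 13 (by norm_num)).trans h.kind'
  bound' := (hr 14 (by norm_num)).trans h.bound'
  kind₀ := (hr 15 (by norm_num)).trans h.kind₀
  bound₀ := (hr 16 (by norm_num)).trans h.bound₀

theorem loadList_spec (hin : StoresInput s₀ L U G G') (a b : Option (Fin n)) :
    Triple (Treats s₀ L U G G' a b) (.ofList loadList) loadList.length
      (Loaded s₀ L U G G' a b) := by
  refine Triple.ofList _ fun s hs => ?_
  have h := hs.1
  have e := hin.graph a b
  have e' := hin.graph' a b
  have e₀ := hin.graph a none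
  rw [← h.mem, ← h.cell] at e
  rw [← h.mem, ← h.cell'] at e'
  -- The edge into `x₀` is in column `0`, so its address is the start of the row.
  rw [← h.mem, vertexNumber, add_zero, ← h.first] at e₀
  rw [← h.one] at e e' e₀
  exact
    { treats := hs.of_eq rfl fun r hr => by interval_cases r <;> rfl
      kind := e.1
      bound := e.2
      kind' := e'.1
      bound' := e'.2
      kind₀ := e₀.1
      bound₀ := e₀.2 }

theorem upperProg_spec (hin : StoresInput s₀ L U G G') (a b : Option (Fin n)) :
    Triple (Loaded s₀ L U G G' a b) upperProg 3
      (fun s => Loaded s₀ L U G G' a b s ∧ s.reg 17 = extBound U a) := by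
  refine Triple.ifLt (T := 2) (T' := 1) (Triple.ofList _ ?_) (Triple.ofList _ ?_)
  · rintro s ⟨hs, hlt⟩
    refine ⟨hs.of_eq rfl fun r hr => by interval_cases r <;> rfl, ?_⟩
    have h := hs.treats.1
    rw [h.zero, h.row] at hlt
    cases a with
    | none => exact absurd hlt (lt_irrefl 0)
    | some i =>
      change s.mem (s.reg 10 + s.reg 2) = (U i : ℤ)
      rw [← hin.upper i, h.mem, h.clocks, h.row, vertexNumber]
      congr 1
      ring
  · rintro s ⟨hs, hlt⟩
    refine ⟨hs.of_eq rfl fun r hr => by interval_cases r <;> rfl, ?_⟩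
    have h := hs.treats.1
    rw [h.zero, h.row] at hlt
    cases a with
    | none => rfl
    | some i => exact absurd (by simp only [vertexNumber]; omega) hlt

theorem lowerProg_spec (hin : StoresInput s₀ L U G G') (a b : Option (Fin n)) :
    Triple (fun s => Loaded s₀ L U G G' a b s ∧ s.reg 17 = extBound U a) lowerProg 2
      (fun s => Loaded s₀ L U G G' a b s ∧ s.reg 17 = extBound U a ∧
        s.reg 18 = extBound L b) := by
  refine Triple.ifLt (T := 1) (T' := 1) (Triple.ofList _ ?_) (Triple.ofList _ ?_)
  · rintro s ⟨⟨hs, hU⟩, hlt⟩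
    refine ⟨hs.of_eq rfl fun r hr => by interval_cases r <;> rfl, hU, ?_⟩
    have h := hs.treats.1
    rw [h.zero, h.col] at hlt
    cases b with
    | none => exact absurd hlt (lt_irrefl 0)
    | some i =>
      change s.mem (s.reg 3) = (L i : ℤ)
      rw [← hin.lower i, h.mem, h.col, vertexNumber, add_comm]
  · rintro s ⟨⟨hs, hU⟩, hlt⟩
    refine ⟨hs.of_eq rfl fun r hr => by interval_cases r <;> rfl, hU, ?_⟩
    have h := hs.treats.1
    rw [h.zero, h.col] at hlt
    cases b with
    | none => rfl
    | some i => exact absurd (by simp only [vertexNumber]; omega) hlt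

/-- The numbers that are compared for the pair `a, b` have been computed. -/
structure Keyed (s₀ : State) (L U : Fin n → ℕ) (G G' : DistGraph (Fin n))
    (a b : Option (Fin n)) (s : State) : Prop where
  treats : Treats s₀ L U G G' a b s
  kind : s.reg 11 = (G a b).kind
  kind' : s.reg 13 = (G' a b).kind
  key : s.reg 19 = 2 * (G a b).bound + (G a b).kind
  key' : s.reg 20 = 2 * (G' a b).bound + (G' a b).kind
  key₀ : s.reg 21 = 2 * (G a none).bound + (G a none).kind
  upper : s.reg 22 = 1 - 2 * (extBound U a : ℤ)
  lower : s.reg 23 = 2 * ((G' a b).bound - extBound L b)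

theorem keyList_spec (a b : Option (Fin n)) :
    Triple (fun s => Loaded s₀ L U G G' a b s ∧ s.reg 17 = extBound U a ∧
        s.reg 18 = extBound L b) (.ofList keyList) keyList.length
      (Keyed s₀ L U G G' a b) := by
  refine Triple.ofList _ fun s hs => ?_
  obtain ⟨h, hU, hL⟩ := hs
  refine ⟨h.treats.of_eq rfl fun r hr => by interval_cases r <;> rfl, h.kind, h.kind',
    ?_, ?_, ?_, ?_, ?_⟩
  · change s.reg 12 + s.reg 12 + s.reg 11 = _
    rw [h.bound, h.kind]; ring
  · change s.reg 14 + s.reg 14 + s.reg 13 = _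
    rw [h.bound', h.kind']; ring
  · change s.reg 16 + s.reg 16 + s.reg 15 = _
    rw [h.bound₀, h.kind₀]; ring
  · change s.reg 7 - s.reg 17 - s.reg 17 = _
    rw [h.treats.1.one, hU]; ring
  · change s.reg 14 - s.reg 18 + (s.reg 14 - s.reg 18) = _
    rw [h.bound', hL]; ring

theorem skip_spec {a b : Option (Fin n)} {P : State → Prop}
    (h : ∀ s, P s → Keyed s₀ L U G G' a b s ∧ ¬ Refutes L U G G' a b) :
    Triple P .skip 0 (fun s => AtCell n s₀ (vertexNumber a) (vertexNumber b) s ∧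
      Answer L U G G' (pairNumber a b + 1) s) :=
  Triple.skip fun s hs => ⟨(h s hs).1.treats.1, (h s hs).1.treats.2.succ (h s hs).2⟩

theorem boundTest_spec {a b : Option (Fin n)} (h₀ : (G a none).kind < 2) {P : State → Prop}
    (h : ∀ s, P s → Keyed s₀ L U G G' a b s ∧ (G' a b).kind < 2 ∧ ((G a b).kind < 2 →
        2 * (G' a b).bound + (G' a b).kind < 2 * (G a b).bound + (G a b).kind)) :
    Triple P boundTest 3 (fun s => AtCell n s₀ (vertexNumber a) (vertexNumber b) s ∧
      Answer L U G G' (pairNumber a b + 1) s) := by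
  refine Triple.ifLt (T := 0) (T' := 2) (skip_spec ?_)
    (Triple.ifLt (T := 1) (T' := 0) (Triple.ofList _ ?_) (skip_spec ?_))
  · rintro s ⟨hs, h1⟩
    obtain ⟨hk, -⟩ := h s hs
    rw [hk.key₀, hk.upper] at h1
    exact ⟨hk, fun hr => ((refutes_iff_kind h₀).1 hr).2.2.1 h1⟩
  · rintro s ⟨⟨hs, h1⟩, h2⟩
    obtain ⟨hk, h3, h4⟩ := h s hs
    rw [hk.key₀, hk.upper] at h1
    rw [hk.key₀, hk.lower] at h2
    exact ⟨hk.treats.1.of_eq rfl fun r hr hr' => by interval_cases r <;> rfl,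
      answer_succ_of_refutes ((refutes_iff_kind h₀).2 ⟨h3, h4, h1, h2⟩) rfl⟩
  · rintro s ⟨⟨hs, h1⟩, h2⟩
    obtain ⟨hk, -⟩ := h s hs
    rw [hk.key₀, hk.lower] at h2
    exact ⟨hk, fun hr => h2 ((refutes_iff_kind h₀).1 hr).2.2.2⟩

theorem pairTest_spec {a b : Option (Fin n)} (h₀ : (G a none).kind < 2) :
    Triple (Keyed s₀ L U G G' a b) pairTest 6
      (fun s => AtCell n s₀ (vertexNumber a) (vertexNumber b) s ∧
        Answer L U G G' (pairNumber a b + 1) s) := by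
  have two : ∀ {s}, Keyed s₀ L U G G' a b s → s.reg 9 = 2 := fun hk => hk.treats.1.two
  refine Triple.ifLt (T := 5) (T' := 0)
    (Triple.ifLt (T := 4) (T' := 3)
      (Triple.ifLt (T := 3) (T' := 0) (boundTest_spec h₀ ?_) (skip_spec ?_))
      (boundTest_spec h₀ ?_)) (skip_spec ?_)
  · rintro s ⟨⟨⟨hk, h1⟩, h2⟩, h3⟩
    rw [two hk, hk.kind'] at h1
    rw [hk.key', hk.key] at h3
    exact ⟨hk, h1, fun _ => h3⟩
  · rintro s ⟨⟨⟨hk, h1⟩, h2⟩, h3⟩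
    rw [two hk, hk.kind] at h2
    rw [hk.key', hk.key] at h3
    exact ⟨hk, fun hr => h3 (((refutes_iff_kind h₀).1 hr).2.1 h2)⟩
  · rintro s ⟨⟨hk, h1⟩, h2⟩
    rw [two hk, hk.kind'] at h1
    rw [two hk, hk.kind] at h2
    exact ⟨hk, h1, fun h => absurd h h2⟩
  · rintro s ⟨hk, h1⟩
    rw [two hk, hk.kind'] at h1
    exact ⟨hk, fun hr => h1 ((refutes_iff_kind h₀).1 hr).1⟩

/-- The invariant of the main loop: the first `k` pairs have been treated. -/
def Invariant (s₀ : State) (L U : Fin n → ℕ) (G G' : DistGraph (Fin n)) (k : ℕ)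
    (s : State) : Prop :=
  ∃ x y : ℕ, y ≤ n ∧ (n + 1) * x + y = k ∧ AtCell n s₀ x y s ∧ Answer L U G G' k s

theorem advanceProg_spec {k x y : ℕ} (hy : y ≤ n) (hk : (n + 1) * x + y = k) :
    Triple (fun s => AtCell n s₀ x y s ∧ Answer L U G G' ((k : ℤ) + 1) s) advanceProg 7
      (Invariant s₀ L U G G' (k + 1)) := by
  have step : Triple (fun s => AtCell n s₀ x y s ∧ Answer L U G G' ((k : ℤ) + 1) s)
      (.ofList [.add 3 3 7, .add 4 4 9, .add 5 5 9]) 3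
      (fun s => AtCell n s₀ x (y + 1) s ∧ Answer L U G G' ((k : ℤ) + 1) s) := by
    refine Triple.ofList _ ?_
    rintro s ⟨h, hA⟩
    refine ⟨⟨⟨h.mem, h.size, h.one, h.zero, h.two, h.clocks⟩, h.row, ?_, ?_, ?_, h.first⟩, hA⟩
    · change s.reg 3 + s.reg 7 = _
      rw [h.col, h.one]
    · change s.reg 4 + s.reg 9 = _
      rw [h.cell, h.two]; ring
    · change s.reg 5 + s.reg 9 = _
      rw [h.cell', h.two]; ring
  refine step.seq (T' := 4) (Triple.ifLt (T := 0) (T' := 3) (Triple.skip ?_) (Triple.ofList _ ?_))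
  · rintro s ⟨⟨h, hA⟩, hlt⟩
    rw [h.col, h.size] at hlt
    exact ⟨x, y + 1, by omega, by omega, by exact_mod_cast h, by exact_mod_cast hA⟩
  · rintro s ⟨⟨h, hA⟩, hlt⟩
    rw [h.col, h.size] at hlt
    obtain rfl : y = n := by omega
    -- After the last column the cell pointers already stand at the start of row `x + 1`.
    refine ⟨x + 1, 0, by omega, by rw [mul_add]; omega,
      ⟨⟨h.mem, h.size, h.one, h.zero, h.two, h.clocks⟩, ?_, rfl, ?_, ?_, ?_⟩,
      by exact_mod_cast hA⟩
    · change s.reg 2 + s.reg 7 = _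
      rw [h.row, h.one]; push_cast; ring
    · change s.reg 4 = _
      rw [h.cell]; push_cast; ring
    · change s.reg 5 = _
      rw [h.cell']; push_cast; ring
    · change s.reg 4 + s.reg 8 = _
      rw [h.cell, h.zero]; push_cast; ring

/-- The cost is `37 = 9 + 3 + 2 + 10 + 6 + 7`, one summand for each of the six stages. -/
theorem pairProg_spec (hin : StoresInput s₀ L U G G') (h₀ : ∀ a, (G a none).kind < 2) {k : ℕ}
    (hk : k < (n + 1) ^ 2) :
    Triple (Invariant s₀ L U G G' k) pairProg 37 (Invariant s₀ L U G G' (k + 1)) := by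
  rintro s ⟨x, y, hy, hxy, hs, hA⟩
  have hx : x ≤ n := by
    by_contra! h
    have : (n + 1) * (n + 1) ≤ (n + 1) * x := Nat.mul_le_mul_left _ h
    nlinarith
  obtain ⟨a, ha⟩ := exists_vertexNumber_eq hx
  obtain ⟨b, hb⟩ := exists_vertexNumber_eq hy
  have hab : pairNumber a b = k := by
    rw [pairNumber, ha, hb, ← hxy]
    push_cast
    ring
  have h1 := pairTest_spec (s₀ := s₀) (L := L) (U := U) (G := G) (G' := G') (b := b) (h₀ a)
  rw [hab, ha, hb] at h1
  refine ((loadList_spec hin a b).seq ((upperProg_spec hin a b).seq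
    ((lowerProg_spec hin a b).seq ((keyList_spec a b).seq
      (h1.seq (advanceProg_spec hy hxy)))))) s ⟨?_, ?_⟩
  · rwa [ha, hb]
  · rwa [hab]

/-- The inclusion test halts after quadratically many steps with the correct answer. -/
theorem inclusionProg_spec (hin : StoresInput s₀ L U G G') (h₀ : ∀ a, (G a none).kind < 2) :
    Triple (· = s₀) inclusionProg (200 * (n ^ 2 + 1))
      (fun s => ((∃ a b, Refutes L U G G' a b) → s.reg 0 = 0) ∧
        ((¬ ∃ a b, Refutes L U G G' a b) → s.reg 0 = 1)) := by
  let I : ℕ → State → Prop := fun k s => Ready n s₀ s ∧ s.reg 0 = 1 ∧ s.reg 2 = 0 ∧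
    s.reg 3 = 0 ∧ s.reg 11 = k ∧ s.reg 5 = k * ((n : ℤ) + 1)
  have h1 : Triple (· = s₀) (.ofList initList) 10 (I 0) := by
    refine Triple.ofList _ ?_
    rintro s rfl
    refine ⟨⟨rfl, ?_, rfl, rfl, rfl, hin.size⟩, rfl, rfl, rfl, rfl, ?_⟩
    · change s.mem 0 + 1 = _
      rw [hin.size]
    · simp [initList, Instr.apply]
  have h2 : Triple (I 0) (.whileLt 11 1 (.ofList [.add 5 5 1, .add 11 11 7]))
      ((n + 1) * (2 + 1) + 1) (I (n + 1)) := by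
    refine Triple.whileLt (n + 1) I ?_ fun k _ => Triple.ofList _ ?_
    · rintro k s ⟨h, -, -, -, h11, -⟩
      rw [h.size, h11]
      omega
    · rintro s ⟨h, hr0, hr2, hr3, h11, h5⟩
      refine ⟨⟨h.mem, h.size, h.one, h.zero, h.two, h.clocks⟩, hr0, hr2, hr3, ?_, ?_⟩
      · change s.reg 11 + s.reg 7 = _
        rw [h11, h.one]; push_cast; ring
      · change s.reg 5 + s.reg 1 = _
        rw [h5, h.size]; push_cast; ring
  have h3 : Triple (I (n + 1)) (.ofList addressList) 5 (Invariant s₀ L U G G' 0) := by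
    refine Triple.ofList _ ?_
    rintro s ⟨h, hr0, hr2, hr3, -, h5⟩
    have e4 : s.reg 10 + s.reg 10 + s.reg 7 = 1 + 2 * (n : ℤ) := by
      rw [h.clocks, h.one]; ring
    refine ⟨0, 0, Nat.zero_le _, rfl,
      ⟨⟨h.mem, h.size, h.one, h.zero, h.two, h.clocks⟩, hr2, hr3, ?_, ?_, ?_⟩, ?_, fun _ => hr0⟩
    · change s.reg 10 + s.reg 10 + s.reg 7 = _
      rw [e4]; push_cast; ring
    · change s.reg 5 + s.reg 5 + (s.reg 10 + s.reg 10 + s.reg 7) = _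
      rw [e4, h5]; push_cast; ring
    · change s.reg 10 + s.reg 10 + s.reg 7 + s.reg 8 = _
      rw [e4, h.zero]; push_cast; ring
    · rintro ⟨a, b, hab, -⟩
      have ha := vertexNumber_nonneg a
      have hb := vertexNumber_nonneg b
      have : 0 ≤ pairNumber a b := by
        unfold pairNumber
        positivity
      exact absurd hab (by simpa using this)
  have h4 : Triple (Invariant s₀ L U G G' 0) (.whileLt 2 1 pairProg)
      ((n + 1) ^ 2 * (37 + 1) + 1) (Invariant s₀ L U G G' ((n + 1) ^ 2)) := by
    refine Triple.whileLt _ _ ?_ fun k hk => pairProg_spec hin h₀ hk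
    -- As `k = (n + 1) * x + y` with `y ≤ n`, the row test `x < n + 1` amounts to `k < (n + 1) ^ 2`.
    rintro k s ⟨x, y, hy, hxy, hs, -⟩
    rw [hs.size, hs.row]
    norm_cast
    constructor
    · intro h
      nlinarith
    · intro h
      by_contra! h'
      nlinarith
  intro s hs
  obtain ⟨s', t, he, ht, x, y, -, -, -, hA⟩ := (h1.seq (h2.seq (h3.seq h4))) s hs
  have key : (∃ a b, pairNumber a b < (((n + 1) ^ 2 : ℕ) : ℤ) ∧ Refutes L U G G' a b) ↔
      ∃ a b, Refutes L U G G' a b := by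
    refine ⟨fun ⟨a, b, _, h⟩ => ⟨a, b, h⟩, fun ⟨a, b, h⟩ => ⟨a, b, ?_, h⟩⟩
    exact_mod_cast pairNumber_lt a b
  rw [Answer, key] at hA
  -- The total is at most `38 * (n + 1) ^ 2 + 3 * (n + 1) + 17`; the constant `200` is generous.
  exact ⟨s', t, he, by nlinarith, hA⟩

end Correctness

end LUZone

theorem mainTheorem3 :
    (∀ (X : Type*) [Finite X] (L U : X → ℕ) (Z Z' : Set (ClockValuation X)) (G G' : DistGraph X),
      IsZone Z → IsZone Z' → Z.Nonempty → Z'.Nonempty →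
      G.IsCanonicalFor Z → G'.IsCanonicalFor Z' →
      (¬ Z ⊆ aLU L U Z' ↔
        ∃ x y : Option X,
          Weight.weak (-(extBound U x : ℤ)) ≤ G x none ∧
          G' x y < G x y ∧
          G' x y + Weight.strict (-(extBound L y : ℤ)) < G x none)) ∧
    (∃ (P : Prog) (C : ℕ),
      ∀ (n : ℕ) (L U : Fin n → ℕ) (Z Z' : Set (ClockValuation (Fin n)))
        (G G' : DistGraph (Fin n)),
        IsZone Z → IsZone Z' → Z.Nonempty → Z'.Nonempty →
        G.IsCanonicalFor Z → G'.IsCanonicalFor Z' →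
        ∀ s : State, StoresInput s L U G G' →
          ∃ (s' : State) (t : ℕ), Exec P s s' t ∧ t ≤ C * (n ^ 2 + 1) ∧
            (Z ⊆ aLU L U Z' → s'.reg 0 = 1) ∧
            (¬ Z ⊆ aLU L U Z' → s'.reg 0 = 0)) := by
  refine ⟨fun X _ L U Z Z' G G' _ _ hZ hZ' h h' => not_subset_aLU_iff hZ hZ' h h',
    inclusionProg, 200, fun n L U Z Z' G G' _ _ hZ hZ' h h' s hin => ?_⟩
  have h₀ : ∀ a, (G a none).kind < 2 := fun a => by
    rw [Weight.kind_lt_two]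
    intro ha
    have := h.le_zero hZ a
    rw [ha] at this
    exact this
  obtain ⟨s', t, he, ht, h1, h2⟩ := inclusionProg_spec hin h₀ s rfl
  have key := not_subset_aLU_iff (L := L) (U := U) hZ hZ' h h'
  exact ⟨s', t, he, ht, fun hs => h2 fun hr => key.2 hr hs, fun hs => h1 (key.1 hs)⟩
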